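/- Let $\mathcal C\subseteq(\mathbb C^2)^{\otimes n}$ be an $[[n,k,d]]$ quantum code, i.e. a subspace of dimension $2^k$, with orthogonal projector $\Pi$, such that for every $n$-qubit Pauli operator $E$ acting non-trivially on fewer than $d$ qubits there is $\eta_E\in\mathbb C$ with $\Pi E\Pi=\eta_E\Pi$. Let $|\psi\rangle\in(\mathbb C^2)^{\otimes n}$ be a pure state (unit vector), let $$\delta=\inf_{\rho}\big\|\rho-|\psi\rangle\langle\psi|\big\|_1$$ be its trace distance from $\mathcal C$, where $\rho$ ranges over all (mixed) states supported on $\mathcal C$ and $\|\cdot\|_1$ is the trace norm (the sum of the singular values, without a factor $\tfrac12$). Assume that $0<\delta<\tfrac12$ and $k>2\delta\log(1/\delta)\,n$, with all logarithms in base $2$. Then $$\mathsf{cc}(|\psi\rangle)\ \ge\ \log\min\Big\{d,\ \frac{k}{2\delta\log(1/\delta)\,n}\Big\}.$$ (For $d=0$ the claim is read as the trivial bound $\mathsf{cc}(|\psi\rangle)\ge 0$.) Here the circuit complexity $\mathsf{cc}(|\psi\rangle)$ is the minimum, over all $m\ge n$ and all $m$-qubit circuits $U$ with $\operatorname{tr}_{[m]\setminus[n]}\big(U|0\rangle\langle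 0|^{\otimes m}U^\dagger\big)=|\psi\rangle\langle\psi|$, of the depth of $U$; a circuit of depth $t$ is a product $U_t\cdots U_1$ of layers, each layer being a tensor product of arbitrary two-qubit unitaries on disjoint pairs of qubits (with any qubits paired, and the remaining qubits left idle). -/

import Mathlib

open scoped ENNReal ComplexOrder

noncomputable section

namespace QCode

/-- Computational-basis labels of a register whose qubits are indexed by `ι`. -/
abbrev Bits (ι : Type) := ι → Fin 2

/-- The Hilbert space of the qubits indexed by `ι`, in computational-basis coordinates. -/
abbrev QSpace (ι : Type) := EuclideanSpace ℂ (Bits ι)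

/-- Operators on the qubits indexed by `ι`, as matrices in the computational basis. -/
abbrev QOp (ι : Type) := Matrix (Bits ι) (Bits ι) ℂ

section States

variable {ι : Type} [Fintype ι] [DecidableEq ι]

/-- Density matrices: positive semidefinite with unit trace. -/
structure IsState (ρ : QOp ι) : Prop where
  posSemidef : ρ.PosSemidef
  trace_eq_one : ρ.trace = 1

/-- The rank-one operator `|ψ⟩⟨ψ|`. -/
def pureState (ψ : QSpace ι) : QOp ι := Matrix.of fun x y => ψ x * star (ψ y)

/-- The trace norm `‖M‖₁`, the sum of the singular values of `M`. -/
def traceNorm (M : QOp ι) : ℝ :=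
  (Matrix.toEuclideanLin M).singularValues.sum fun _ s => s

/-- The vector `|0⟩^{⊗ ι}`. -/
def zeroKet (ι : Type) [Fintype ι] : QSpace ι :=
  WithLp.toLp 2 fun x => if x = 0 then 1 else 0

end States

section Codes

/-- The single-qubit Pauli labels. -/
inductive Pauli
  | I | X | Y | Z
  deriving DecidableEq

/-- The Pauli matrices. -/
def Pauli.mat : Pauli → Matrix (Fin 2) (Fin 2) ℂ
  | .I => !![1, 0; 0, 1]
  | .X => !![0, 1; 1, 0]
  | .Y => !![0, -Complex.I; Complex.I, 0]
  | .Z => !![1, 0; 0, -1]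

variable {n : ℕ}

/-- The tensor product of the Pauli matrices `P i` over all qubits `i`. -/
def pauliString (P : Fin n → Pauli) : QOp (Fin n) :=
  Matrix.of fun x y => ∏ i, (P i).mat (x i) (y i)

/-- The number of qubits on which a Pauli string is not the identity. -/
def pauliWeight (P : Fin n → Pauli) : ℕ :=
  (Finset.univ.filter fun i => P i ≠ Pauli.I).card

/-- The matrix of the orthogonal projector `Π_C` onto the subspace `C`. -/
def codeProj (C : Submodule ℂ (QSpace (Fin n))) : QOp (Fin n) :=
  Matrix.toEuclideanLin.symm (C.starProjection : QSpace (Fin n) →ₗ[ℂ] QSpace (Fin n))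

/-- `C` is an `[[n, k, d]]` code: it encodes `k` qubits, i.e. has dimension `2 ^ k`, and every
Pauli error of weight less than `d` satisfies the Knill–Laflamme condition `Π E Π = η_E Π`.
(The phases of the Pauli group are irrelevant here, as they can be absorbed in `η_E`.) -/
structure IsCode (C : Submodule ℂ (QSpace (Fin n))) (k d : ℕ) : Prop where
  finrank_eq : Module.finrank ℂ C = 2 ^ k
  knill_laflamme : ∀ P : Fin n → Pauli, pauliWeight P < d →
    ∃ η : ℂ, codeProj C * pauliString P * codeProj C = η • codeProj C

/-- Code-states: the (pure or mixed) states supported on `C`. -/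
def codeStates (C : Submodule ℂ (QSpace (Fin n))) : Set (QOp (Fin n)) :=
  {ρ | IsState ρ ∧ codeProj C * ρ * codeProj C = ρ}

/-- The trace distance `inf_{ρ ∈ C} ‖ρ - σ‖₁` between a state `σ` and the code `C`. -/
def traceDistToCode (σ : QOp (Fin n)) (C : Submodule ℂ (QSpace (Fin n))) : ℝ :=
  sInf ((fun ρ => traceNorm (ρ - σ)) '' codeStates C)

end Codes

section Circuits

variable {ι : Type} [Fintype ι] [DecidableEq ι]

/-- A gate: an arbitrary two-qubit unitary `U` on two distinct qubits `a`, `b` (all-to-all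
connectivity). -/
structure Gate (ι : Type) where
  a : ι
  b : ι
  ne : a ≠ b
  U : Matrix.unitaryGroup (Fin 2 × Fin 2) ℂ

/-- The two qubits on which a gate acts. -/
def Gate.support (g : Gate ι) : Finset ι := {g.a, g.b}

/-- The action of a gate on the whole register: `U` on the qubits `a`, `b`, tensored with the
identity on the others. -/
def Gate.toOp (g : Gate ι) : QOp ι :=
  Matrix.of fun x y =>
    if ∀ i, i ∉ g.support → x i = y i then (g.U : Matrix _ _ ℂ) (x g.a, x g.b) (y g.a, y g.b)
    else 0

/-- One layer of a circuit: finitely many gates on pairwise disjoint pairs of qubits. -/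
structure Layer (ι : Type) [DecidableEq ι] where
  gates : List (Gate ι)
  disjoint : gates.Pairwise fun g h => Disjoint g.support h.support

/-- The unitary of a layer. The gates commute, so the product is their tensor product. -/
def Layer.toOp (L : Layer ι) : QOp ι := (L.gates.map Gate.toOp).prod

/-- A circuit is the list of its layers, the layer applied first at the head; its depth is the
length of the list. -/
abbrev Circuit (ι : Type) [DecidableEq ι] := List (Layer ι)

/-- The unitary `U_t ⋯ U_1` of the circuit with layers `[U_1, …, U_t]`. -/
def circuitOp : Circuit ι → QOp ι
  | [] => 1
  | L :: c => circuitOp c * L.toOp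

/-- The output state `U |0⟩⟨0| U†` of a circuit started in the all-zero state. -/
def circuitOutput (c : Circuit ι) : QOp ι :=
  circuitOp c * pureState (zeroKet ι) * (circuitOp c).conjTranspose

/-- The partial trace over the ancilla qubits `κ`. -/
def traceAnc {κ : Type} [Fintype κ] [DecidableEq κ] (ρ : QOp (ι ⊕ κ)) : QOp ι :=
  Matrix.of fun x y => ∑ z : Bits κ, ρ (Sum.elim x z) (Sum.elim y z)

/-- The circuit complexity of an `n`-qubit state `ρ`: the least depth of a circuit on `m = n + a`
qubits, for any number `a` of ancillas, whose output is a purification of `ρ`, i.e. reduces to `ρ`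
on the first `n` qubits. (It would be `⊤` if there were no such circuit.) -/
def cc {n : ℕ} (ρ : QOp (Fin n)) : ℕ∞ :=
  ⨅ (a : ℕ) (c : Circuit (Fin n ⊕ Fin a)) (_ : traceAnc (circuitOutput c) = ρ),
    (c.length : ℕ∞)

end Circuits

end QCode

end

/-! Suppose a circuit `U` of depth t with 2^t < d prepares ψ. A purification of a pure state is a
product ψ ⊗ φ, so T = U†(· ⊗ φ) is an isometry with Tψ = |0…0⟩ (`exists_isometry_of_circuit`). For
each input qubit j let O_j = T†|1⟩⟨1|_j T. It is supported on the forward light cone of j, which has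
at most 2^t < d qubits, so by Knill–Laflamme all code-states give O_j the same expectation η_j.
Since O_j ψ = 0 and code-states come within δ of ψ, up to arbitrarily small error, trace-norm
duality gives η_j ≤ δ. If no system qubit is reachable from j, then O_j is a scalar and η_j = 0.

Now pull the maximally mixed code-state Π/2^k back by T and measure in the computational basis. No
outcome has probability above 2^(-k), while bit j equals 1 with probability η_j. Only the at most
n·2^t inputs in the backward cones of the n system qubits contribute entropy, each at most h(δ)
(`log_le_card_mul_binEntropy`). Hence k ≤ n·2^t·h(δ) in bits (`code_dimension_le_of_circuit`), and
h(δ) ≤ 2δ log(1/δ) gives the bound. -/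

namespace QCode

/-! ### Operators supported on a set of qubits and their Pauli expansion. -/

section Support

variable {ι : Type} [Fintype ι] [DecidableEq ι]

/-- `M` acts as the identity on all qubits outside `S`. -/
def SupportedOn (S : Set ι) (M : QOp ι) : Prop :=
  ∀ i, i ∉ S → ∀ x y : Bits ι,
    (x i ≠ y i → M x y = 0) ∧ M (x + Pi.single i 1) (y + Pi.single i 1) = M x y

/-- The tensor product of single-qubit matrices. -/
def tensorOp (A : ι → Matrix (Fin 2) (Fin 2) ℂ) : QOp ι :=
  Matrix.of fun x y => ∏ i, A i (x i) (y i)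

omit [Fintype ι] in
theorem SupportedOn.mono {S T : Set ι} {M : QOp ι} (hM : SupportedOn S M) (h : S ⊆ T) :
    SupportedOn T M := fun i hi => hM i fun hS => hi (h hS)

theorem SupportedOn.mul {S : Set ι} {M N : QOp ι} (hM : SupportedOn S M)
    (hN : SupportedOn S N) : SupportedOn S (M * N) := by
  intro i hi x y
  constructor
  · intro hxy
    rw [Matrix.mul_apply]
    refine Finset.sum_eq_zero fun z _ => ?_
    by_cases hz : x i = z i
    · rw [(hN i hi z y).1 (fun h => hxy (hz.trans h)), mul_zero]
    · rw [(hM i hi x z).1 hz, zero_mul]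
  · rw [Matrix.mul_apply, Matrix.mul_apply,
      ← Equiv.sum_comp (Equiv.addRight (Pi.single i (1 : Fin 2)))]
    refine Finset.sum_congr rfl fun z _ => ?_
    simp only [Equiv.coe_addRight]
    rw [(hM i hi x z).2, (hN i hi z y).2]

omit [Fintype ι] in
theorem SupportedOn.conjTranspose {S : Set ι} {M : QOp ι} (hM : SupportedOn S M) :
    SupportedOn S M.conjTranspose := by
  intro i hi x y
  refine ⟨fun h => ?_, ?_⟩
  · rw [Matrix.conjTranspose_apply, (hM i hi y x).1 h.symm, star_zero]
  · rw [Matrix.conjTranspose_apply, Matrix.conjTranspose_apply, (hM i hi y x).2]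

theorem tensorOp_mul (A B : ι → Matrix (Fin 2) (Fin 2) ℂ) :
    tensorOp A * tensorOp B = tensorOp fun i => A i * B i := by
  ext x y
  simp only [tensorOp, Matrix.mul_apply, Matrix.of_apply, ← Finset.prod_mul_distrib]
  rw [Finset.prod_univ_sum, Fintype.piFinset_univ]

instance : Fintype Pauli :=
  ⟨{Pauli.I, Pauli.X, Pauli.Y, Pauli.Z}, fun p => by cases p <;> simp⟩

/-- Entrywise form of ∑ P ⊗ P = 2 · SWAP. Its n-qubit version gives the completeness of the Pauli
basis. -/
theorem sum_pauli_mul (a b c d : Fin 2) :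
    ∑ p : Pauli, p.mat a b * p.mat c d = if a = d ∧ b = c then 2 else 0 := by
  have h : (Finset.univ : Finset Pauli) = {Pauli.I, Pauli.X, Pauli.Y, Pauli.Z} := rfl
  rw [h]
  fin_cases a <;> fin_cases b <;> fin_cases c <;> fin_cases d <;> simp [Pauli.mat] <;> norm_num

theorem sum_tensorOp_pauli_mul (x y z w : Bits ι) :
    ∑ P : ι → Pauli, tensorOp (fun i => (P i).mat) x y * tensorOp (fun i => (P i).mat) z w =
      if x = w ∧ y = z then (2 : ℂ) ^ Fintype.card ι else 0 := by
  simp only [tensorOp, Matrix.of_apply, ← Finset.prod_mul_distrib]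
  have := Finset.prod_univ_sum (fun _ : ι => (Finset.univ : Finset Pauli))
    (fun i p => p.mat (x i) (y i) * p.mat (z i) (w i))
  rw [Fintype.piFinset_univ] at this
  rw [← this]
  simp only [sum_pauli_mul]
  split_ifs with h
  · obtain ⟨rfl, rfl⟩ := h
    simp
  · by_cases hx : x = w
    · obtain ⟨i, hi⟩ := Function.ne_iff.1 (fun hy => h ⟨hx, hy⟩ : y ≠ z)
      exact Finset.prod_eq_zero (Finset.mem_univ i) (if_neg fun h => hi h.2)
    · obtain ⟨i, hi⟩ := Function.ne_iff.1 hx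
      exact Finset.prod_eq_zero (Finset.mem_univ i) (if_neg fun h => hi h.1)

theorem eq_sum_pauli (M : QOp ι) :
    M = ∑ P : ι → Pauli, (((2 : ℂ) ^ Fintype.card ι)⁻¹ *
      (tensorOp (fun i => (P i).mat) * M).trace) • tensorOp fun i => (P i).mat := by
  ext x y
  have h2 : (2 : ℂ) ^ Fintype.card ι ≠ 0 := by positivity
  simp only [Matrix.sum_apply, Matrix.smul_apply, smul_eq_mul, Matrix.trace, Matrix.diag_apply,
    Matrix.mul_apply]
  have : ∀ P : ι → Pauli, (((2 : ℂ) ^ Fintype.card ι)⁻¹ *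
      ∑ z, ∑ w, tensorOp (fun i => (P i).mat) z w * M w z) * tensorOp (fun i => (P i).mat) x y =
      ∑ z, ∑ w, (((2 : ℂ) ^ Fintype.card ι)⁻¹ * M w z) *
        (tensorOp (fun i => (P i).mat) x y * tensorOp (fun i => (P i).mat) z w) := by
    intro P
    simp only [Finset.mul_sum, Finset.sum_mul]
    refine Finset.sum_congr rfl fun z _ => Finset.sum_congr rfl fun w _ => ?_
    ring
  simp only [this]
  rw [Finset.sum_comm]
  have hcomm : ∀ z, ∑ P : ι → Pauli, ∑ w, (((2 : ℂ) ^ Fintype.card ι)⁻¹ * M w z) *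
        (tensorOp (fun i => (P i).mat) x y * tensorOp (fun i => (P i).mat) z w) =
      ∑ w, (((2 : ℂ) ^ Fintype.card ι)⁻¹ * M w z) *
        if x = w ∧ y = z then (2 : ℂ) ^ Fintype.card ι else 0 := by
    intro z
    rw [Finset.sum_comm]
    simp only [← Finset.mul_sum, sum_tensorOp_pauli_mul]
  simp only [hcomm]
  rw [Finset.sum_eq_single y, Finset.sum_eq_single x]
  · simp
    field_simp
  · intro w _ hw
    rw [if_neg (fun h => hw h.1.symm), mul_zero]
  · simp
  · intro z _ hz
    refine Finset.sum_eq_zero fun w _ => ?_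
    rw [if_neg (fun h => hz h.2.symm), mul_zero]
  · simp

/-- Shifting a qubit in both indices of `Z` at that qubit flips the sign. -/
theorem tensorOp_pauli_shift_of_eq_Z {P : ι → Pauli} {i : ι} (hi : P i = Pauli.Z) {x y : Bits ι} :
    tensorOp (fun i => (P i).mat) (x + Pi.single i 1) (y + Pi.single i 1) =
      - tensorOp (fun i => (P i).mat) x y := by
  simp only [tensorOp, Matrix.of_apply]
  rw [← Finset.mul_prod_erase _ _ (Finset.mem_univ i), ← Finset.mul_prod_erase _ _
    (Finset.mem_univ i), ← neg_mul]
  congr 1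
  · simp only [hi, Pi.add_apply, Pi.single_eq_same]
    generalize x i = a
    generalize y i = b
    fin_cases a <;> fin_cases b <;> simp [Pauli.mat]
  · refine Finset.prod_congr rfl fun j hj => ?_
    simp [Finset.ne_of_mem_erase hj]

/-- Outside `S`, `M` is diagonal in qubit i and invariant under flipping it. A Pauli X or Y there
has no diagonal entries, and a Z changes sign under the flip, making the trace equal to its own
negative. -/
theorem SupportedOn.trace_pauli_mul_eq_zero {S : Set ι} {M : QOp ι} (hM : SupportedOn S M)
    {P : ι → Pauli} {i : ι} (hi : i ∉ S) (hP : P i ≠ Pauli.I) :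
    (tensorOp (fun i => (P i).mat) * M).trace = 0 := by
  simp only [Matrix.trace, Matrix.diag_apply, Matrix.mul_apply]
  by_cases hZ : P i = Pauli.Z
  · rw [← self_eq_neg]
    conv_lhs => rw [← Equiv.sum_comp (Equiv.addRight (Pi.single i (1 : Fin 2)))]
    rw [← Finset.sum_neg_distrib]
    refine Finset.sum_congr rfl fun x _ => ?_
    conv_lhs => rw [← Equiv.sum_comp (Equiv.addRight (Pi.single i (1 : Fin 2)))]
    rw [← Finset.sum_neg_distrib]
    refine Finset.sum_congr rfl fun y _ => ?_
    simp only [Equiv.coe_addRight]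
    rw [(hM i hi y x).2, tensorOp_pauli_shift_of_eq_Z hZ, neg_mul]
  · refine Finset.sum_eq_zero fun x _ => Finset.sum_eq_zero fun y _ => ?_
    by_cases hxy : y i = x i
    · refine mul_eq_zero_of_left (Finset.prod_eq_zero (Finset.mem_univ i) ?_) _
      rw [hxy]
      generalize x i = a
      cases h : P i <;> simp_all <;> fin_cases a <;> simp [Pauli.mat]
    · rw [(hM i hi y x).1 hxy, mul_zero]

theorem SupportedOn.mem_span {S : Set ι} {M : QOp ι} (hM : SupportedOn S M) :
    M ∈ Submodule.span ℂ ((fun P : ι → Pauli => tensorOp fun i => (P i).mat) ''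
      {P | ∀ i, i ∉ S → P i = Pauli.I}) := by
  rw [eq_sum_pauli M]
  refine Submodule.sum_mem _ fun P _ => ?_
  by_cases hP : ∀ i, i ∉ S → P i = Pauli.I
  · exact Submodule.smul_mem _ _ (Submodule.subset_span ⟨P, hP, rfl⟩)
  · push Not at hP
    obtain ⟨i, hi, h⟩ := hP
    rw [hM.trace_pauli_mul_eq_zero hi h, mul_zero, zero_smul]
    exact Submodule.zero_mem _

theorem Pauli.mat_I : Pauli.I.mat = 1 := by
  ext a b
  fin_cases a <;> fin_cases b <;> simp [Pauli.mat]

/-- By bilinearity it suffices to treat Pauli strings, which at each qubit have an identity factor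
on one side. -/
theorem SupportedOn.commute {S T : Set ι} (hST : Disjoint S T) {M N : QOp ι}
    (hM : SupportedOn S M) (hN : SupportedOn T N) : Commute M N := by
  have hM' := hM.mem_span
  have hN' := hN.mem_span
  clear hM hN
  induction hM' using Submodule.span_induction with
  | zero => exact Commute.zero_left _
  | add _ _ _ _ h₁ h₂ => exact h₁.add_left h₂
  | smul _ _ _ h => exact h.smul_left _
  | mem A hA =>
    obtain ⟨P, hP, rfl⟩ := hA
    induction hN' using Submodule.span_induction with
    | zero => exact Commute.zero_right _
    | add _ _ _ _ h₁ h₂ => exact h₁.add_right h₂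
    | smul _ _ _ h => exact h.smul_right _
    | mem B hB =>
      obtain ⟨Q, hQ, rfl⟩ := hB
      rw [commute_iff_eq]
      simp only [tensorOp_mul]
      congr 1
      ext1 i
      by_cases hi : i ∈ S
      · rw [hQ i (Set.disjoint_left.1 hST hi), Pauli.mat_I, mul_one, one_mul]
      · rw [hP i hi, Pauli.mat_I, mul_one, one_mul]

omit [DecidableEq ι] in
theorem tensorOp_one : tensorOp (fun _ : ι => (1 : Matrix (Fin 2) (Fin 2) ℂ)) = 1 := by
  ext x y
  simp only [tensorOp, Matrix.of_apply, Matrix.one_apply]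
  split_ifs with h
  · simp [h]
  · obtain ⟨i, hi⟩ := Function.ne_iff.1 h
    exact Finset.prod_eq_zero (Finset.mem_univ i) (if_neg hi)

theorem SupportedOn.eq_smul_one {M : QOp ι} (hM : SupportedOn ∅ M) : ∃ c : ℂ, M = c • 1 := by
  have h := hM.mem_span
  have : {P : ι → Pauli | ∀ i, i ∉ (∅ : Set ι) → P i = Pauli.I} = {fun _ => Pauli.I} := by
    ext P
    simp [funext_iff]
  rw [this, Set.image_singleton, Submodule.mem_span_singleton] at h
  obtain ⟨c, rfl⟩ := h
  exact ⟨c, by simp only [Pauli.mat_I, tensorOp_one]⟩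

end Support

/-! ### Unitarity of circuits, light cones and their sizes. -/

section Cones

variable {ι : Type} [Fintype ι] [DecidableEq ι]

theorem Gate.supportedOn (g : Gate ι) : SupportedOn (g.support : Set ι) g.toOp := by
  intro i hi x y
  have hi' : i ∉ g.support := by simpa using hi
  have ha : g.a ≠ i := fun h => hi' (by simp [Gate.support, ← h])
  have hb : g.b ≠ i := fun h => hi' (by simp [Gate.support, ← h])
  simp only [Gate.toOp, Matrix.of_apply]
  refine ⟨fun h => if_neg fun h' => h (h' i hi'), ?_⟩
  simp [ha, hb]

/-- Only the four labels obtained from `x` by rewriting the two bits of the gate contribute to a row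
of `g.toOp`. -/
theorem sum_toOp (g : Gate ι) (x : Bits ι) (f : Bits ι → ℂ) :
    ∑ z, (if ∀ i, i ∉ g.support → x i = z i then f z else 0) =
      ∑ p : Fin 2 × Fin 2, f (Function.update (Function.update x g.a p.1) g.b p.2) := by
  rw [← Finset.sum_filter]
  symm
  refine Finset.sum_bij' (fun p _ => Function.update (Function.update x g.a p.1) g.b p.2)
    (fun z _ => (z g.a, z g.b)) ?_ ?_ ?_ ?_ ?_
  · intro p _
    simp only [Finset.mem_filter, Finset.mem_univ, true_and]
    intro i hi
    have ha : i ≠ g.a := fun h => hi (by simp [Gate.support, h])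
    have hb : i ≠ g.b := fun h => hi (by simp [Gate.support, h])
    simp [ha, hb]
  · simp
  · intro p _
    simp [g.ne]
  · intro z hz
    simp only [Finset.mem_filter, Finset.mem_univ, true_and] at hz
    ext1 i
    by_cases hb : i = g.b
    · subst hb; simp
    by_cases ha : i = g.a
    · subst ha; simp [hb]
    · simp only [Function.update_of_ne hb, Function.update_of_ne ha]
      exact hz i (by simp [Gate.support, ha, hb])
  · simp

theorem Gate.toOp_mul_conjTranspose (g : Gate ι) : g.toOp * g.toOp.conjTranspose = 1 := by
  ext x y
  obtain ⟨u, hu'⟩ : ∃ u : Fin 2 × Fin 2 → Fin 2 × Fin 2 → ℂ,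
    u = (g.U : Matrix (Fin 2 × Fin 2) (Fin 2 × Fin 2) ℂ) := ⟨_, rfl⟩
  have hu : ∀ p q : Fin 2 × Fin 2, ∑ r : Fin 2 × Fin 2, u p r * star (u q r)
      = if p = q then 1 else 0 := by
    rw [hu']
    intro p q
    have := congrFun (congrFun (Matrix.mem_unitaryGroup_iff.1 g.U.2) p) q
    rw [Matrix.mul_apply, Matrix.one_apply] at this
    simpa [Matrix.star_apply] using this
  have hentry : ∀ x y : Bits ι, g.toOp x y =
      if ∀ i, i ∉ g.support → x i = y i then u (x g.a, x g.b) (y g.a, y g.b) else 0 := by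
    rw [hu']
    exact fun _ _ => rfl
  simp only [Matrix.mul_apply, Matrix.conjTranspose_apply, hentry, ite_mul, zero_mul]
  rw [sum_toOp g x]
  by_cases h : ∀ i, i ∉ g.support → x i = y i
  · have h' : ∀ p : Fin 2 × Fin 2, (∀ i, i ∉ g.support →
        y i = Function.update (Function.update x g.a p.1) g.b p.2 i) := by
      intro p i hi
      have ha : i ≠ g.a := fun h => hi (by simp [Gate.support, h])
      have hb : i ≠ g.b := fun h => hi (by simp [Gate.support, h])
      simp [ha, hb, h i hi]
    simp only [if_pos (h' _)]
    have := hu (x g.a, x g.b) (y g.a, y g.b)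
    simp only [Function.update_self, Function.update_of_ne g.ne, Prod.mk.eta]
    rw [this, Matrix.one_apply]
    congr 1
    rw [Prod.mk.injEq, eq_iff_iff]
    refine ⟨fun hab => ?_, fun h => by simp [h]⟩
    ext1 i
    by_cases hb : i = g.b
    · rw [hb, hab.2]
    by_cases ha : i = g.a
    · rw [ha, hab.1]
    · exact h i (by simp [Gate.support, ha, hb])
  · have hxy : x ≠ y := fun h' => h (by simp [h'])
    rw [Matrix.one_apply_ne hxy]
    refine Finset.sum_eq_zero fun p _ => ?_
    rw [if_neg, star_zero, mul_zero]
    intro h'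
    refine h fun i hi => ?_
    have ha : i ≠ g.a := fun h => hi (by simp [Gate.support, h])
    have hb : i ≠ g.b := fun h => hi (by simp [Gate.support, h])
    rw [h' i hi]
    simp [ha, hb]

/-- Some gate of the list acts on both `i` and `j`, or `i = j`. -/
def linked (l : List (Gate ι)) (i j : ι) : Prop :=
  i = j ∨ ∃ g ∈ l, i ∈ g.support ∧ j ∈ g.support

omit [Fintype ι] in
theorem linked_comm {l : List (Gate ι)} {i j : ι} : linked l i j ↔ linked l j i := by
  unfold linked
  rw [eq_comm]
  simp only [and_comm]

/-- A gate disjoint from the current support commutes through and cancels with its adjoint; any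
other gate adds at most its own two qubits. -/
theorem SupportedOn.gates_conj {l : List (Gate ι)}
    (hl : l.Pairwise fun g h => Disjoint g.support h.support) {S : Set ι} {M : QOp ι}
    (hM : SupportedOn S M) :
    SupportedOn {i | ∃ j ∈ S, linked l j i}
      ((l.map Gate.toOp).prod * M * (l.map Gate.toOp).prod.conjTranspose) := by
  induction l with
  | nil => simpa [linked] using hM
  | cons g l ih =>
    obtain ⟨hg, hl⟩ := List.pairwise_cons.1 hl
    have ih := ih hl
    have hmono : {i | ∃ j ∈ S, linked l j i} ⊆ {i | ∃ j ∈ S, linked (g :: l) j i} := by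
      rintro i ⟨j, hj, h⟩
      refine ⟨j, hj, h.imp id ?_⟩
      rintro ⟨g', hg', h⟩
      exact ⟨g', List.mem_cons_of_mem _ hg', h⟩
    rw [List.map_cons, List.prod_cons, Matrix.conjTranspose_mul]
    set L := (l.map Gate.toOp).prod
    have e : g.toOp * L * M * (L.conjTranspose * g.toOp.conjTranspose) =
      g.toOp * (L * M * L.conjTranspose) * g.toOp.conjTranspose := by noncomm_ring
    rw [e]
    by_cases hd : Disjoint (g.support : Set ι) {i | ∃ j ∈ S, linked l j i}
    · rw [(g.supportedOn.commute hd ih).eq, mul_assoc, g.toOp_mul_conjTranspose, mul_one]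
      exact ih.mono hmono
    · obtain ⟨i, hi, j, hj, hji⟩ := Set.not_disjoint_iff.1 hd
      -- The gates of a layer are disjoint, so no gate of `l` touches i ∈ `g.support`; the link from
      -- j to i can only be j = i.
      have hjg : j ∈ g.support := by
        rcases hji with rfl | ⟨g', hg', -, hig'⟩
        · exact hi
        · exact absurd hig' (Finset.disjoint_left.1 (hg g' hg') hi)
      have hsub : (g.support : Set ι) ⊆ {i | ∃ j ∈ S, linked (g :: l) j i} := fun i' hi' =>
        ⟨j, hj, Or.inr ⟨g, List.mem_cons_self, hjg, hi'⟩⟩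
      exact ((g.supportedOn.mono hsub).mul (ih.mono hmono)).mul
        (g.supportedOn.conjTranspose.mono hsub)

/-- There is a path from the input qubit `j` to the output qubit `i` through the circuit. -/
def reach : Circuit ι → ι → ι → Prop
  | [], j, i => j = i
  | L :: c, j, i => ∃ l, linked L.gates j l ∧ reach c l i

theorem SupportedOn.circuit_conj (c : Circuit ι) {S : Set ι} {M : QOp ι} (hM : SupportedOn S M) :
    SupportedOn {i | ∃ j ∈ S, reach c j i}
      (circuitOp c * M * (circuitOp c).conjTranspose) := by
  induction c generalizing S M with
  | nil => simpa [circuitOp, reach] using hM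
  | cons L c ih =>
    have h := ih (hM.gates_conj L.disjoint)
    rw [circuitOp, Layer.toOp, Matrix.conjTranspose_mul]
    set A := (L.gates.map Gate.toOp).prod
    have e : circuitOp c * A * M * (A.conjTranspose * (circuitOp c).conjTranspose) =
      circuitOp c * (A * M * A.conjTranspose) * (circuitOp c).conjTranspose := by noncomm_ring
    rw [e]
    refine h.mono ?_
    rintro i ⟨l, ⟨j, hj, hjl⟩, hli⟩
    exact ⟨j, hj, l, hjl, hli⟩

theorem circuitOp_mul_conjTranspose (c : Circuit ι) :
    circuitOp c * (circuitOp c).conjTranspose = 1 := by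
  have hgates : ∀ l : List (Gate ι),
      (l.map Gate.toOp).prod * (l.map Gate.toOp).prod.conjTranspose = 1 := by
    intro l
    induction l with
    | nil => simp
    | cons g l ih =>
      rw [List.map_cons, List.prod_cons, Matrix.conjTranspose_mul, mul_assoc,
        ← mul_assoc _ _ g.toOp.conjTranspose, ih, one_mul, g.toOp_mul_conjTranspose]
  induction c with
  | nil => simp [circuitOp]
  | cons L c ih =>
    rw [circuitOp, Matrix.conjTranspose_mul, mul_assoc,
        ← mul_assoc _ _ (circuitOp c).conjTranspose, Layer.toOp, hgates, one_mul, ih]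

omit [Fintype ι] in
theorem exists_linked_subset (L : Layer ι) (i : ι) :
    ∃ s : Finset ι, s.card ≤ 2 ∧ ∀ j, linked L.gates i j → j ∈ s := by
  obtain ⟨l, hl⟩ := L
  induction l with
  | nil => exact ⟨{i}, by simp, fun j hj => by simpa [linked, eq_comm] using hj⟩
  | cons g l ih =>
    obtain ⟨hg, hl⟩ := List.pairwise_cons.1 hl
    by_cases hi : i ∈ g.support
    · refine ⟨g.support, Finset.card_le_two, ?_⟩
      rintro j (rfl | ⟨g', hg', hig', hjg'⟩)
      · exact hi
      · rcases List.mem_cons.1 hg' with rfl | hmem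
        · exact hjg'
        · exact absurd hig' (Finset.disjoint_left.1 (hg g' hmem) hi)
    · obtain ⟨s, hs, h⟩ := ih hl
      refine ⟨s, hs, ?_⟩
      rintro j (rfl | ⟨g', hg', hig', hjg'⟩)
      · exact h _ (Or.inl rfl)
      · rcases List.mem_cons.1 hg' with rfl | hmem
        · exact absurd hig' hi
        · exact h j (Or.inr ⟨g', hmem, hig', hjg'⟩)

omit [Fintype ι] in
-- Forward cone of an input: each layer at most doubles it. This size is compared with the distance
-- d.
theorem exists_reach_subset (c : Circuit ι) (j : ι) :
    ∃ s : Finset ι, s.card ≤ 2 ^ c.length ∧ ∀ i, reach c j i → i ∈ s := by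
  induction c generalizing j with
  | nil => exact ⟨{j}, by simp, fun i hi => by simpa [reach, eq_comm] using hi⟩
  | cons L c ih =>
    choose s hs h using ih
    obtain ⟨t, ht, h'⟩ := exists_linked_subset L j
    refine ⟨t.biUnion s, ?_, ?_⟩
    · refine (Finset.card_biUnion_le_card_mul _ _ _ fun i _ => hs i).trans ?_
      rw [List.length_cons, pow_succ']
      exact Nat.mul_le_mul_right _ ht
    · rintro i ⟨l, hl, hli⟩
      exact Finset.mem_biUnion.2 ⟨l, h' l hl, h l i hli⟩

omit [Fintype ι] in
-- Backward cone of an output, used to count the inputs that can influence the system qubits.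
theorem exists_reach_superset (c : Circuit ι) (i : ι) :
    ∃ s : Finset ι, s.card ≤ 2 ^ c.length ∧ ∀ j, reach c j i → j ∈ s := by
  induction c with
  | nil => exact ⟨{i}, by simp, fun j hj => by simpa [reach] using hj⟩
  | cons L c ih =>
    obtain ⟨t, ht, h'⟩ := ih
    choose s hs h using exists_linked_subset L
    refine ⟨t.biUnion s, ?_, ?_⟩
    · refine (Finset.card_biUnion_le_card_mul _ _ _ fun i _ => hs i).trans ?_
      rw [List.length_cons, pow_succ]
      exact Nat.mul_le_mul_right _ ht
    · rintro j ⟨l, hl, hli⟩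
      exact Finset.mem_biUnion.2 ⟨l, h' l hli, h l j (linked_comm.1 hl)⟩

end Cones

/-! ### Duality between trace norm and operator norm. -/

section TraceNorm

variable {ι : Type} [Fintype ι] [DecidableEq ι]

open scoped Matrix.Norms.L2Operator

theorem traceNorm_eq_sum_fin (M : QOp ι) :
    traceNorm M = ∑ i : Fin (Module.finrank ℂ (QSpace ι)),
      (Matrix.toEuclideanLin M).singularValues i := by
  rw [traceNorm, Finsupp.sum_of_support_subset
    (s := Finset.range (Module.finrank ℂ (QSpace ι))) _ _ _ (fun _ _ => rfl), Finset.sum_range]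
  intro i hi
  by_contra h
  exact Finsupp.mem_support_iff.1 hi
    (LinearMap.singularValues_of_finrank_le _ (by simpa using h))

/-- The trace is evaluated in an orthonormal eigenbasis b_i of D†D, where ‖D b_i‖ is the i-th
singular value; each term is then bounded by Cauchy–Schwarz. -/
theorem norm_trace_mul_le_traceNorm (D O : QOp ι) (hO : ‖O‖ ≤ 1) :
    ‖(D * O).trace‖ ≤ traceNorm D := by
  set A := Matrix.toEuclideanLin D
  have hA := A.isSymmetric_adjoint_comp_self
  set b := hA.eigenvectorBasis rfl
  have htr : (D * O).trace = ∑ i, inner ℂ (b i) (Matrix.toEuclideanLin (O * D) (b i)) := by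
    rw [← LinearMap.trace_eq_sum_inner, Matrix.toEuclideanLin, Matrix.toLpLin_eq_toLin,
      Matrix.trace_toLin_eq, Matrix.trace_mul_comm]
  rw [htr, traceNorm_eq_sum_fin]
  refine (norm_sum_le _ _).trans (Finset.sum_le_sum fun i _ => ?_)
  have hb : ‖b i‖ = 1 := b.orthonormal.1 i
  have h1 : ‖A (b i)‖ = A.singularValues i := by
    rw [← sq_eq_sq₀ (norm_nonneg _) (A.singularValues_nonneg _),
      A.sq_singularValues_fin rfl i]
    have := hA.apply_eigenvectorBasis rfl i
    have h2 : inner ℂ (b i) ((A.adjoint ∘ₗ A) (b i)) = ((hA.eigenvalues rfl i : ℝ) : ℂ) := by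
      rw [this, inner_smul_right, inner_self_eq_norm_sq_to_K, hb]
      simp
    rw [LinearMap.comp_apply, LinearMap.adjoint_inner_right, inner_self_eq_norm_sq_to_K] at h2
    apply Complex.ofReal_injective
    rw [Complex.ofReal_pow]
    exact h2
  have h2 : Matrix.toEuclideanLin (O * D) (b i) = Matrix.toEuclideanLin O (A (b i)) := by
    simp [A, Matrix.toLpLin_apply, Matrix.mulVec_mulVec]
  calc _ ≤ ‖b i‖ * ‖Matrix.toEuclideanLin (O * D) (b i)‖ := norm_inner_le_norm _ _
    _ = ‖Matrix.toEuclideanLin O (A (b i))‖ := by rw [hb, one_mul, h2]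
    _ ≤ ‖O‖ * ‖A (b i)‖ := Matrix.l2_opNorm_mulVec O (A (b i))
    _ ≤ 1 * ‖A (b i)‖ := by gcongr
    _ = _ := by rw [one_mul, h1]

end TraceNorm

/-! ### The code projector and local indistinguishability. -/

section CodeProjector

variable {n : ℕ}

theorem codeProj_mul_self (C : Submodule ℂ (QSpace (Fin n))) :
    codeProj C * codeProj C = codeProj C := by
  apply Matrix.toEuclideanLin.injective
  ext1 v
  have h : ∀ v, Matrix.toEuclideanLin (codeProj C) v = C.starProjection v := by
    intro v
    simp [codeProj]
  have h' : Matrix.toEuclideanLin (codeProj C * codeProj C) v =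
      Matrix.toEuclideanLin (codeProj C) (Matrix.toEuclideanLin (codeProj C) v) := by
    simp [Matrix.toLpLin_apply, Matrix.mulVec_mulVec]
  rw [h', h, h, Submodule.starProjection_eq_self_iff]
  exact Submodule.starProjection_apply_mem _ _

theorem codeProj_conjTranspose (C : Submodule ℂ (QSpace (Fin n))) :
    (codeProj C).conjTranspose = codeProj C := by
  apply Matrix.toEuclideanLin.injective
  rw [Matrix.toEuclideanLin_conjTranspose_eq_adjoint]
  symm
  rw [LinearMap.eq_adjoint_iff]
  intro x y
  simp [codeProj, Submodule.inner_starProjection_left_eq_right]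

theorem codeProj_trace (C : Submodule ℂ (QSpace (Fin n))) :
    (codeProj C).trace = Module.finrank ℂ C := by
  have h : LinearMap.IsProj C (C.starProjection : QSpace (Fin n) →ₗ[ℂ] QSpace (Fin n)) :=
    ⟨fun x => Submodule.starProjection_apply_mem _ _,
      fun x hx => Submodule.starProjection_eq_self_iff.2 hx⟩
  rw [← h.trace, ← Matrix.trace_toLin_eq _ (PiLp.basisFun 2 ℂ (Bits (Fin n))),
    ← Matrix.toLpLin_eq_toLin]
  simp [codeProj]

/-- The Knill–Laflamme condition is linear in the error, so it passes from Pauli strings to their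
span. -/
theorem IsCode.exists_sandwich_eq_smul {C : Submodule ℂ (QSpace (Fin n))} {k d : ℕ}
    (hC : IsCode C k d) {S : Finset (Fin n)} (hS : S.card < d) {O : QOp (Fin n)}
    (hO : SupportedOn (S : Set (Fin n)) O) :
    ∃ η : ℂ, codeProj C * O * codeProj C = η • codeProj C := by
  have hO' := hO.mem_span
  clear hO
  induction hO' using Submodule.span_induction with
  | zero => exact ⟨0, by simp⟩
  | add A B _ _ hA hB =>
    obtain ⟨a, ha⟩ := hA
    obtain ⟨b, hb⟩ := hB
    exact ⟨a + b, by rw [mul_add, add_mul, ha, hb, add_smul]⟩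
  | smul c A _ hA =>
    obtain ⟨a, ha⟩ := hA
    exact ⟨c * a, by rw [Matrix.mul_smul, Matrix.smul_mul, ha, smul_smul]⟩
  | mem A hA =>
    obtain ⟨P, hP, rfl⟩ := hA
    refine hC.knill_laflamme P (lt_of_le_of_lt (Finset.card_le_card fun i hi => ?_) hS)
    by_contra h
    exact (Finset.mem_filter.1 hi).2 (hP i (by simpa using h))

/-- Code-states have the same expectation `η` on an observable with `Π O Π = η Π`. -/
theorem trace_mul_of_mem_codeStates {C : Submodule ℂ (QSpace (Fin n))} {ρ O : QOp (Fin n)}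
    (hρ : ρ ∈ codeStates C) {η : ℂ} (hO : codeProj C * O * codeProj C = η • codeProj C) :
    (ρ * O).trace = η := by
  set P := codeProj C
  have hP : P * P = P := codeProj_mul_self C
  obtain ⟨hst, hr⟩ := hρ
  have hρP : ρ * P = ρ := by
    rw [← hr, mul_assoc, hP]
  have e1 : (ρ * O).trace = (ρ * (P * O * P)).trace := by
    conv_lhs => rw [← hr, mul_assoc, mul_assoc, Matrix.trace_mul_comm]
    congr 1
    noncomm_ring
  rw [e1, hO, Matrix.mul_smul, hρP, Matrix.trace_smul, hst.trace_eq_one, smul_eq_mul, mul_one]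

end CodeProjector

/-! ### Adjoining ancillas; purifications of pure states. -/

section Purification

variable {ι κ : Type} [Fintype ι] [DecidableEq ι] [Fintype κ] [DecidableEq κ]

/-- The linear map `v ↦ v ⊗ φ`. -/
def appendAncilla (ι : Type) [Fintype ι] [DecidableEq ι] (φ : Bits κ → ℂ) :
    Matrix (Bits (ι ⊕ κ)) (Bits ι) ℂ :=
  Matrix.of fun s y => if s ∘ Sum.inl = y then φ (s ∘ Sum.inr) else 0

theorem sum_bits_sum (f : Bits (ι ⊕ κ) → ℂ) :
    ∑ s, f s = ∑ x : Bits ι, ∑ z : Bits κ, f (Sum.elim x z) := by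
  rw [← Fintype.sum_prod_type', ← Equiv.sum_comp (Equiv.sumArrowEquivProdArrow ι κ (Fin 2)).symm]
  rfl

theorem appendAncilla_conjTranspose_mul_mul (φ : Bits κ → ℂ) (M : QOp (ι ⊕ κ)) (x y : Bits ι) :
    ((appendAncilla ι φ).conjTranspose * M * appendAncilla ι φ) x y =
      ∑ z, ∑ w, star (φ z) * M (Sum.elim x z) (Sum.elim y w) * φ w := by
  simp only [Matrix.mul_apply, sum_bits_sum, Matrix.conjTranspose_apply, appendAncilla,
    Matrix.of_apply, Sum.elim_comp_inl, Sum.elim_comp_inr]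
  rw [Finset.sum_eq_single y]
  · simp only [if_true]
    rw [Finset.sum_comm]
    refine Finset.sum_congr rfl fun w _ => ?_
    rw [← Finset.sum_mul]
    congr 1
    rw [Finset.sum_eq_single x]
    · simp
    · intro x' _ hx
      simp [hx]
    · simp
  · intro y' _ hy
    simp [hy]
  · simp

theorem SupportedOn.compress {S : Set (ι ⊕ κ)} {M : QOp (ι ⊕ κ)} (hM : SupportedOn S M)
    (φ : Bits κ → ℂ) :
    SupportedOn (Sum.inl ⁻¹' S)
      ((appendAncilla ι φ).conjTranspose * M * appendAncilla ι φ) := by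
  intro i hi x y
  have hi' : Sum.inl i ∉ S := hi
  rw [appendAncilla_conjTranspose_mul_mul, appendAncilla_conjTranspose_mul_mul]
  constructor
  · intro h
    refine Finset.sum_eq_zero fun z _ => Finset.sum_eq_zero fun w _ => ?_
    rw [(hM _ hi' _ _).1 (by simpa using h), mul_zero, zero_mul]
  · have hadd : ∀ (x : Bits ι) (z : Bits κ),
        (Sum.elim (x + Pi.single i 1) z : Bits (ι ⊕ κ)) =
          Sum.elim x z + Pi.single (Sum.inl i) 1 := by
      intro x z
      ext1 s
      cases s with
      | inl j => simp [Pi.single_apply]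
      | inr j => simp
    simp only [hadd, (hM _ hi' _ _).2]

theorem appendAncilla_isometry {φ : Bits κ → ℂ} (hφ : ∑ z, φ z * star (φ z) = 1) :
    (appendAncilla ι φ).conjTranspose * appendAncilla ι φ = 1 := by
  have h : (appendAncilla ι φ).conjTranspose * appendAncilla ι φ =
    (appendAncilla ι φ).conjTranspose * (1 : QOp (ι ⊕ κ)) * appendAncilla ι φ := by rw [Matrix.mul_one]
  ext x y
  rw [h, appendAncilla_conjTranspose_mul_mul]
  have he : ∀ z w : Bits κ, ((Sum.elim x z : Bits (ι ⊕ κ)) = Sum.elim y w) ↔ (x = y ∧ z = w) :=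
    fun z w => ⟨fun h => ⟨funext fun i => congrFun h (Sum.inl i),
      funext fun i => congrFun h (Sum.inr i)⟩, fun h => by rw [h.1, h.2]⟩
  simp only [Matrix.one_apply, he]
  by_cases hxy : x = y
  · simp only [hxy, true_and, mul_ite, mul_one, mul_zero, ite_mul, zero_mul, Finset.sum_ite_eq,
      Finset.mem_univ, if_true]
    rw [← hφ]
    exact Finset.sum_congr rfl fun z _ => mul_comm _ _
  · simp [hxy]

/-- A purification of a pure state is a product state. -/
theorem exists_product_of_traceAnc_pure {ψ : Bits ι → ℂ} (hψ : ∑ x, ψ x * star (ψ x) = 1)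
    {Φ : Bits (ι ⊕ κ) → ℂ}
    (h : ∀ x y, ∑ z, Φ (Sum.elim x z) * star (Φ (Sum.elim y z)) = ψ x * star (ψ y)) :
    ∃ φ : Bits κ → ℂ, ∑ z, φ z * star (φ z) = 1 ∧ ∀ x z, Φ (Sum.elim x z) = ψ x * φ z := by
  -- The ancilla state is the partial inner product ⟨ψ|Φ⟩.
  set φ : Bits κ → ℂ := fun z => ∑ x, star (ψ x) * Φ (Sum.elim x z) with hφ
  have h1 : ∀ x, ∑ z, Φ (Sum.elim x z) * star (φ z) = ψ x := by
    intro x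
    simp only [hφ, star_sum, star_mul', star_star, Finset.mul_sum]
    rw [Finset.sum_comm]
    calc _ = ∑ y, ψ y * ∑ z, Φ (Sum.elim x z) * star (Φ (Sum.elim y z)) := by
          refine Finset.sum_congr rfl fun y _ => ?_
          rw [Finset.mul_sum]
          exact Finset.sum_congr rfl fun z _ => by ring
      _ = ψ x * ∑ y, ψ y * star (ψ y) := by
          rw [Finset.mul_sum]
          exact Finset.sum_congr rfl fun y _ => by rw [h]; ring
      _ = ψ x := by rw [hψ, mul_one]
  have h2 : ∑ z, φ z * star (φ z) = 1 := by
    calc _ = ∑ z, ∑ x, star (ψ x) * (Φ (Sum.elim x z) * star (φ z)) := by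
          refine Finset.sum_congr rfl fun z _ => ?_
          change (∑ x, star (ψ x) * Φ (Sum.elim x z)) * star (φ z) = _
          simp only [Finset.sum_mul, mul_assoc]
      _ = ∑ x, star (ψ x) * ψ x := by
          rw [Finset.sum_comm]
          simp only [← Finset.mul_sum, h1]
      _ = 1 := by
          rw [← hψ]
          exact Finset.sum_congr rfl fun x _ => mul_comm _ _
  refine ⟨φ, h2, fun x => ?_⟩
  -- For each x, the squared norm of the defect Φ(x,·) − ψ(x)φ expands into four terms equal to
  -- ±|ψ(x)|², which cancel.
  have h3 : ∑ z, (Φ (Sum.elim x z) - ψ x * φ z) * star (Φ (Sum.elim x z) - ψ x * φ z) = 0 := by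
    have h1' : ∑ z, φ z * star (Φ (Sum.elim x z)) = star (ψ x) := by
      rw [← h1 x, star_sum]
      exact Finset.sum_congr rfl fun z _ => by simp [mul_comm]
    have e : ∀ z, (Φ (Sum.elim x z) - ψ x * φ z) * star (Φ (Sum.elim x z) - ψ x * φ z) =
        Φ (Sum.elim x z) * star (Φ (Sum.elim x z)) - star (ψ x) * (Φ (Sum.elim x z) * star (φ z))
          - ψ x * (φ z * star (Φ (Sum.elim x z))) + ψ x * star (ψ x) * (φ z * star (φ z)) := by
      intro z
      simp only [star_sub, star_mul']
      ring
    simp only [e, Finset.sum_add_distrib, Finset.sum_sub_distrib, ← Finset.mul_sum, h, h1, h1', h2]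
    ring
  intro z
  have h4 : ∑ z, ‖Φ (Sum.elim x z) - ψ x * φ z‖ ^ 2 = 0 := by
    have : ∀ w : ℂ, w * star w = ((‖w‖ ^ 2 : ℝ) : ℂ) := fun w => by
      rw [← starRingEnd_apply, Complex.mul_conj, Complex.normSq_eq_norm_sq]
    simp only [this] at h3
    exact_mod_cast h3
  have := (Finset.sum_eq_zero_iff_of_nonneg fun _ _ => by positivity).1 h4 z (Finset.mem_univ z)
  exact sub_eq_zero.1 (norm_eq_zero.1 (pow_eq_zero_iff two_ne_zero |>.1 this))

end Purification

/-! ### The observables |1⟩⟨1| on single qubits, and diagonals of projectors. -/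

section Occupation

variable {ι κ : Type} [Fintype ι] [DecidableEq ι] [Fintype κ] [DecidableEq κ]

/-- The projector onto `|1⟩` on the qubit `j`. -/
def occupation (j : ι) : QOp ι := Matrix.diagonal fun x => if x j = 1 then 1 else 0

theorem supportedOn_occupation (j : ι) : SupportedOn {j} (occupation j) := by
  intro i hi x y
  have hij : j ≠ i := fun h => hi h.symm
  refine ⟨fun h => Matrix.diagonal_apply_ne _ fun h' => h (by rw [h']), ?_⟩
  simp only [occupation, Matrix.diagonal_apply, add_left_inj, Pi.add_apply,
    Pi.single_eq_of_ne hij, add_zero]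

open scoped Matrix.Norms.L2Operator in
theorem norm_conj_occupation_le {T : Matrix (Bits κ) (Bits ι) ℂ} (hT : T.conjTranspose * T = 1)
    (j : κ) : ‖T.conjTranspose * occupation j * T‖ ≤ 1 := by
  have hT1 : ‖T‖ * ‖T‖ = 1 := by
    rw [← Matrix.l2_opNorm_conjTranspose_mul_self, hT, norm_one]
  have hn : ‖occupation j‖ ≤ 1 := by
    rw [occupation, Matrix.l2_opNorm_diagonal]
    refine (pi_norm_le_iff_of_nonneg zero_le_one).2 fun x => ?_
    split_ifs <;> simp
  calc _ ≤ ‖T.conjTranspose‖ * ‖occupation j‖ * ‖T‖ :=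
        (Matrix.l2_opNorm_mul _ _).trans (by gcongr; exact Matrix.l2_opNorm_mul _ _)
    _ = ‖occupation j‖ * (‖T‖ * ‖T‖) := by rw [Matrix.l2_opNorm_conjTranspose]; ring
    _ ≤ 1 := by rw [hT1, mul_one]; exact hn

/-- Diagonal entries of an orthogonal projector lie in `[0, 1]`. -/
theorem diag_mem_of_isProjector {Q : QOp ι} (hQ : Q.conjTranspose = Q) (hQ2 : Q * Q = Q)
    (x : Bits ι) : 0 ≤ (Q x x).re ∧ (Q x x).re ≤ 1 := by
  have h : (Q x x).re = ∑ y, ‖Q x y‖ ^ 2 := by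
    conv_lhs => rw [← hQ2, Matrix.mul_apply]
    rw [Complex.re_sum]
    refine Finset.sum_congr rfl fun y _ => ?_
    have : Q y x = star (Q x y) := by
      conv_lhs => rw [← hQ]
      rfl
    rw [this, ← starRingEnd_apply, Complex.mul_conj, Complex.normSq_eq_norm_sq, Complex.ofReal_re]
  have h0 : 0 ≤ (Q x x).re := by rw [h]; positivity
  -- Q_xx = ∑_y |Q_xy|² dominates its own term |Q_xx|², which forces Q_xx ≤ 1.
  have h1 : ‖Q x x‖ ^ 2 ≤ (Q x x).re := by
    rw [h]
    exact Finset.single_le_sum (f := fun y => ‖Q x y‖ ^ 2) (fun _ _ => by positivity)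
      (Finset.mem_univ x)
  have h2 : (Q x x).re ≤ ‖Q x x‖ := Complex.re_le_norm _
  exact ⟨h0, by nlinarith⟩

end Occupation

/-! ### Classical entropy bounds. -/

section Entropy

/-- Comparing the secants of log from 1 to δ and from 1 to 1 − δ gives (1−δ) log(1/(1−δ)) ≤ δ
log(1/δ): the second entropy term is at most the first. -/
theorem binEntropy_le_two_mul {δ : ℝ} (h0 : 0 < δ) (h1 : δ < 1 / 2) :
    Real.binEntropy δ ≤ 2 * (δ * Real.log (1 / δ)) := by
  have h := strictConcaveOn_log_Ioi.concaveOn.neg.secant_mono (a := 1) (x := δ) (y := 1 - δ)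
    (by simp) (by simpa using h0) (by simp; linarith) (by linarith) (by linarith) (by linarith)
  simp only [Pi.neg_apply, Real.log_one, neg_zero, sub_zero] at h
  have e : 1 - δ - 1 = -δ := by ring
  rw [e, neg_div_neg_eq, ← neg_div_neg_eq, neg_neg, neg_sub,
    div_le_div_iff₀ (by linarith) h0] at h
  rw [Real.binEntropy, one_div, Real.log_inv, Real.log_inv]
  nlinarith

variable {ι : Type} [Fintype ι] [DecidableEq ι]

/-- Gibbs' inequality against a product distribution: a distribution on bit strings of min-entropy
at least `log N`, whose bits are `1` with probability at most `δ`, and `0` outside `A`. -/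
theorem log_le_card_mul_binEntropy {p : Bits ι → ℝ} {N δ : ℝ}
    (hp0 : ∀ x, 0 ≤ p x) (hp1 : ∑ x, p x = 1) (hpN : ∀ x, p x ≤ N⁻¹)
    (hδ0 : 0 < δ) (hδ1 : δ < 1 / 2) (A : Finset ι)
    (hA : ∀ j ∈ A, ∑ x, (if x j = 1 then p x else 0) ≤ δ)
    (hA' : ∀ j ∉ A, ∑ x, (if x j = 1 then p x else 0) = 0) :
    Real.log N ≤ A.card * Real.binEntropy δ := by
  -- The comparison distribution: independent Bernoulli(δ) bits on `A`, deterministic zeros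
  -- elsewhere.
  set w : ι → Fin 2 → ℝ := fun j b =>
    if j ∈ A then (if b = 1 then δ else 1 - δ) else (if b = 1 then 0 else 1) with hw
  set q : Bits ι → ℝ := fun x => ∏ j, w j (x j) with hq
  have hw0 : ∀ j b, 0 ≤ w j b := by
    intro j b
    simp only [hw]
    split_ifs <;> linarith
  have hq0 : ∀ x, 0 ≤ q x := fun x => Finset.prod_nonneg fun j _ => hw0 j _
  have hq1 : ∑ x, q x = 1 := by
    have := Finset.prod_univ_sum (fun _ : ι => (Finset.univ : Finset (Fin 2))) w
    rw [Fintype.piFinset_univ] at this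
    rw [hq, ← this]
    refine Finset.prod_eq_one fun j _ => ?_
    simp only [hw, Fin.sum_univ_two]
    by_cases hj : j ∈ A <;> simp [hj]
  -- `ell` is log q wherever p > 0. Being a sum of single-bit terms, it has a p-mean that depends
  -- only on the marginals.
  set ell : Bits ι → ℝ := fun x =>
    ∑ j ∈ A, (Real.log (1 - δ) + if x j = 1 then Real.log δ - Real.log (1 - δ) else 0) with hell
  have hlog : ∀ x, 0 < p x → 0 < q x ∧ Real.log (q x) = ell x := by
    intro x hx
    have hz : ∀ j, j ∉ A → x j ≠ 1 := by
      intro j hj h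
      have := (Finset.sum_eq_zero_iff_of_nonneg fun y _ => by
        split_ifs
        exacts [hp0 y, le_rfl]).1 (hA' j hj) x (Finset.mem_univ x)
      rw [if_pos h] at this
      exact hx.ne' this
    have hqA : q x = ∏ j ∈ A, w j (x j) := by
      symm
      refine Finset.prod_subset (Finset.subset_univ A) fun j _ hj => ?_
      simp [hw, hj, hz j hj]
    have hpos : ∀ j ∈ A, 0 < w j (x j) := by
      intro j hj
      simp only [hw, if_pos hj]
      split_ifs <;> linarith
    rw [hqA]
    refine ⟨Finset.prod_pos hpos, ?_⟩
    rw [Real.log_prod fun j hj => (hpos j hj).ne']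
    refine Finset.sum_congr rfl fun j hj => ?_
    simp only [hw, if_pos hj]
    split_ifs <;> ring
  -- From log(q/p) ≤ q/p − 1 and log p ≤ −log N. The right side sums to 0.
  have hpt : ∀ x, p x * ell x + p x * Real.log N ≤ q x - p x := by
    intro x
    rcases (hp0 x).eq_or_lt with h | h
    · rw [← h]
      simpa using hq0 x
    · obtain ⟨hqx, hl⟩ := hlog x h
      have h1 := Real.log_le_sub_one_of_pos (div_pos hqx h)
      rw [Real.log_div hqx.ne' h.ne', hl] at h1
      have h2 : Real.log (p x) ≤ - Real.log N := by
        rw [← Real.log_inv]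
        exact Real.log_le_log h (hpN x)
      have h3 : p x * (ell x + Real.log N) ≤ p x * (q x / p x - 1) :=
        mul_le_mul_of_nonneg_left (by linarith) h.le
      rw [mul_sub, mul_div_cancel₀ _ h.ne'] at h3
      linarith
  have hsum := Finset.sum_le_sum fun x (_ : x ∈ Finset.univ) => hpt x
  rw [Finset.sum_add_distrib, Finset.sum_sub_distrib, ← Finset.sum_mul, hp1, hq1] at hsum
  have hexp : ∑ x, p x * ell x = ∑ j ∈ A, (Real.log (1 - δ) +
      (Real.log δ - Real.log (1 - δ)) * ∑ x, (if x j = 1 then p x else 0)) := by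
    simp only [hell, Finset.mul_sum]
    rw [Finset.sum_comm]
    refine Finset.sum_congr rfl fun j _ => ?_
    simp only [mul_add, Finset.sum_add_distrib]
    rw [← Finset.sum_mul, hp1, one_mul]
    congr 1
    refine Finset.sum_congr rfl fun x _ => ?_
    split_ifs <;> ring
  have hlow : ∑ j ∈ A, -Real.binEntropy δ ≤ ∑ x, p x * ell x := by
    rw [hexp]
    refine Finset.sum_le_sum fun j hj => ?_
    -- Here δ < 1/2 matters: the coefficient of the marginal is nonpositive, so replacing the
    -- marginal by its upper bound δ gives a lower bound.
    have hlt : Real.log δ ≤ Real.log (1 - δ) := Real.log_le_log hδ0 (by linarith)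
    rw [Real.binEntropy, Real.log_inv, Real.log_inv]
    nlinarith [hA j hj]
  rw [Finset.sum_const, nsmul_eq_mul] at hlow
  linarith

end Entropy

/-! ### From a shallow circuit to a bound on the code dimension. -/

section Main

variable {n : ℕ}

theorem exists_mem_codeStates_lt {σ : QOp (Fin n)} {C : Submodule ℂ (QSpace (Fin n))} {δ ε : ℝ}
    (h : traceDistToCode σ C = δ) (hδ : 0 < δ) (hε : 0 < ε) :
    ∃ ρ ∈ codeStates C, traceNorm (ρ - σ) < δ + ε := by
  -- An empty infimum in ℝ equals 0, which δ > 0 excludes.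
  have hne : ((fun ρ => traceNorm (ρ - σ)) '' codeStates C).Nonempty := by
    by_contra hne
    rw [Set.not_nonempty_iff_eq_empty] at hne
    rw [traceDistToCode, hne, Real.sInf_empty] at h
    exact hδ.ne h
  obtain ⟨_, ⟨ρ, hρ, rfl⟩, hlt⟩ := exists_lt_of_csInf_lt hne
    (show sInf ((fun ρ => traceNorm (ρ - σ)) '' codeStates C) < δ + ε by
      rw [← traceDistToCode, h]; linarith)
  exact ⟨ρ, hρ, hlt⟩

theorem pureState_eq_vecMulVec {ι : Type} [Fintype ι] [DecidableEq ι] (ψ : QSpace ι) :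
    pureState ψ = Matrix.vecMulVec ψ.ofLp (star ψ.ofLp) := rfl

/-- A circuit preparing the pure state `ψ` yields an isometry `T` taking `ψ` to `|0⟩`, such that
single-qubit observables on its range pull back to observables on the light cone. -/
theorem exists_isometry_of_circuit {a : ℕ} {c : Circuit (Fin n ⊕ Fin a)} {ψ : QSpace (Fin n)}
    (hψ : ‖ψ‖ = 1) (hc : traceAnc (circuitOutput c) = pureState ψ) :
    ∃ T : Matrix (Bits (Fin n ⊕ Fin a)) (Bits (Fin n)) ℂ, T.conjTranspose * T = 1 ∧
      T.mulVec ψ.ofLp = (zeroKet (Fin n ⊕ Fin a)).ofLp ∧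
      ∀ j, SupportedOn {i | reach c j (Sum.inl i)} (T.conjTranspose * occupation j * T) := by
  set U := circuitOp c
  have hU : U * U.conjTranspose = 1 := circuitOp_mul_conjTranspose c
  set Φ : Bits (Fin n ⊕ Fin a) → ℂ := U.mulVec (zeroKet (Fin n ⊕ Fin a)).ofLp
  have hout : circuitOutput c = Matrix.vecMulVec Φ (star Φ) := by
    rw [circuitOutput, pureState_eq_vecMulVec, Matrix.mul_vecMulVec, Matrix.vecMulVec_mul,
      Matrix.star_mulVec]
  have hψ' : ∑ x, ψ.ofLp x * star (ψ.ofLp x) = 1 := by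
    have h := EuclideanSpace.norm_sq_eq ψ
    rw [hψ, one_pow] at h
    have e : ∀ w : ℂ, w * star w = ((‖w‖ ^ 2 : ℝ) : ℂ) := fun w => by
      rw [← starRingEnd_apply, Complex.mul_conj, Complex.normSq_eq_norm_sq]
    simp only [e]
    exact_mod_cast h.symm
  obtain ⟨φ, hφ, hprod⟩ := exists_product_of_traceAnc_pure hψ' (Φ := Φ) fun x y => by
    have h := congrFun (congrFun hc x) y
    rw [hout] at h
    exact h
  set V := appendAncilla (Fin n) φ
  have hV : V.conjTranspose * V = 1 := appendAncilla_isometry hφ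
  have hVψ : V.mulVec ψ.ofLp = Φ := by
    ext1 s
    rw [← Sum.elim_comp_inl_inr s, hprod]
    simp [V, Matrix.mulVec, dotProduct, appendAncilla, mul_comm]
  have hO : ∀ M, (U.conjTranspose * V).conjTranspose * M * (U.conjTranspose * V) =
      V.conjTranspose * (U * M * U.conjTranspose) * V := by
    intro M
    rw [Matrix.conjTranspose_mul, Matrix.conjTranspose_conjTranspose]
    simp only [Matrix.mul_assoc]
  -- With V v = v ⊗ φ, pulling M back through T = U†V gives V†(U M U†)V: spread M along its light
  -- cone, then compress away the ancillas.
  refine ⟨U.conjTranspose * V, ?_, ?_, fun j => ?_⟩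
  · have := hO 1
    rwa [Matrix.mul_one, Matrix.mul_one, hU, Matrix.mul_one, hV] at this
  · rw [← Matrix.mulVec_mulVec, hVψ, Matrix.mulVec_mulVec, mul_eq_one_comm.1 hU, Matrix.one_mulVec]
  · rw [hO]
    refine (((supportedOn_occupation j).circuit_conj c).compress φ).mono ?_
    rintro i ⟨j', rfl, h⟩
    exact h

theorem code_dimension_le_of_circuit {k d a : ℕ} {C : Submodule ℂ (QSpace (Fin n))}
    (hC : IsCode C k d) {ψ : QSpace (Fin n)} (hψ : ‖ψ‖ = 1) {δ : ℝ}
    (hdist : traceDistToCode (pureState ψ) C = δ) (hδ0 : 0 < δ) (hδ1 : δ < 1 / 2)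
    {c : Circuit (Fin n ⊕ Fin a)} (hc : traceAnc (circuitOutput c) = pureState ψ)
    (hd : 2 ^ c.length < d) :
    k * Real.log 2 ≤ n * 2 ^ c.length * Real.binEntropy δ := by
  classical
  obtain ⟨T, hT, hTψ, hsupp⟩ := exists_isometry_of_circuit hψ hc
  set P := codeProj C
  have hP : P * P = P := codeProj_mul_self C
  -- The code projector carried to the input side. `p` below is the computational-basis distribution
  -- of the maximally mixed code-state there.
  set Q := T * P * T.conjTranspose
  have hQ : Q.conjTranspose = Q := by
    simp only [Q, Matrix.conjTranspose_mul, Matrix.conjTranspose_conjTranspose,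
      P, codeProj_conjTranspose, Matrix.mul_assoc]
  have hQ2 : Q * Q = Q := by
    calc Q * Q = T * (P * (T.conjTranspose * T) * P) * T.conjTranspose := by
          simp only [Q, Matrix.mul_assoc]
      _ = Q := by rw [hT, Matrix.mul_one, hP]
  have htrP : P.trace = 2 ^ k := by
    rw [codeProj_trace, hC.finrank_eq]
    push_cast
    rfl
  set O : Fin n ⊕ Fin a → QOp (Fin n) := fun j => T.conjTranspose * occupation j * T
  set p : Bits (Fin n ⊕ Fin a) → ℝ := fun x => (2 ^ k)⁻¹ * (Q x x).re
  have hOψ : ∀ j, O j * pureState ψ = 0 := by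
    intro j
    have hz : (occupation j).mulVec (zeroKet (Fin n ⊕ Fin a)).ofLp = 0 := by
      ext x
      rw [occupation, Matrix.mulVec_diagonal]
      by_cases hx : x = 0 <;> simp [zeroKet, hx]
    rw [pureState_eq_vecMulVec, Matrix.mul_vecMulVec, ← Matrix.mulVec_mulVec, hTψ,
      ← Matrix.mulVec_mulVec, hz, Matrix.mulVec_zero, Matrix.zero_vecMulVec]
  have hmarg : ∀ j (η : ℂ), P * O j * P = η • P →
      ∑ x, (if x j = 1 then p x else 0) = η.re := by
    intro j η h
    have h1 : (occupation j * Q).trace = η * 2 ^ k := by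
      calc _ = (P * O j).trace := by
            rw [show occupation j * Q = occupation j * T * P * T.conjTranspose by
                simp only [Q, Matrix.mul_assoc], Matrix.trace_mul_comm,
              Matrix.trace_mul_comm P]
            simp only [O, Matrix.mul_assoc]
        _ = (P * O j * P).trace := by
            rw [Matrix.trace_mul_comm (P * O j), ← Matrix.mul_assoc P P, hP]
        _ = _ := by rw [h, Matrix.trace_smul, htrP, smul_eq_mul]
    have h2 : (occupation j * Q).trace = ∑ x, (if x j = 1 then Q x x else 0) := by
      simp [Matrix.trace, occupation, Matrix.diagonal_mul]
    have h3 : ∑ x, (if x j = 1 then (Q x x).re else 0) = η.re * 2 ^ k := by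
      have := congrArg Complex.re (h2.symm.trans h1)
      rw [Complex.re_sum] at this
      have e : (η * 2 ^ k).re = η.re * 2 ^ k := by
        have : (2 ^ k : ℂ) = ((2 ^ k : ℝ) : ℂ) := by push_cast; rfl
        rw [this, Complex.re_mul_ofReal]
      rw [← e, ← this]
      exact Finset.sum_congr rfl fun x _ => by split_ifs <;> simp
    have h4 : ∀ x : Bits (Fin n ⊕ Fin a), (if x j = 1 then p x else 0) =
        (2 ^ k)⁻¹ * (if x j = 1 then (Q x x).re else 0) := fun x => by split_ifs <;> simp [p]
    simp only [h4, ← Finset.mul_sum, h3]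
    field_simp
  have hp1 : ∑ x, p x = 1 := by
    have h : Q.trace = 2 ^ k := by
      rw [Matrix.trace_mul_comm, ← Matrix.mul_assoc, hT, Matrix.one_mul, htrP]
    have h' : ∑ x, (Q x x).re = 2 ^ k := by
      have e : (2 ^ k : ℂ).re = 2 ^ k := by
        have : (2 ^ k : ℂ) = ((2 ^ k : ℝ) : ℂ) := by push_cast; rfl
        rw [this, Complex.ofReal_re]
      rw [← e, ← h, Matrix.trace, Complex.re_sum]
      rfl
    simp only [p, ← Finset.mul_sum, h']
    field_simp
  -- Only inputs with a path to a system qubit count, so the bound is independent of the number of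
  -- ancillas.
  set A : Finset (Fin n ⊕ Fin a) := Finset.univ.filter fun j => ∃ i : Fin n, reach c j (Sum.inl i)
  have hcone : ∀ j, ∃ η : ℂ, P * O j * P = η • P := by
    intro j
    obtain ⟨s, hs, h⟩ := exists_reach_subset c j
    refine hC.exists_sandwich_eq_smul
      (S := Finset.univ.filter fun i => Sum.inl i ∈ s) ?_ ((hsupp j).mono fun i hi => ?_)
    · refine lt_of_le_of_lt (le_trans ?_ hs) hd
      exact Finset.card_le_card_of_injOn Sum.inl (fun i hi => by simpa using hi)
        Sum.inl_injective.injOn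
    · simpa using h _ hi
  have hlog := log_le_card_mul_binEntropy (p := p) (N := 2 ^ k)
    (fun x => mul_nonneg (by positivity) (diag_mem_of_isProjector hQ hQ2 x).1) hp1
    (fun x => mul_le_of_le_one_right (by positivity) (diag_mem_of_isProjector hQ hQ2 x).2)
    hδ0 hδ1 A ?_ ?_
  · rw [Real.log_pow] at hlog
    refine hlog.trans (mul_le_mul_of_nonneg_right ?_ (Real.binEntropy_nonneg hδ0.le (by linarith)))
    choose s hs h using exists_reach_superset c
    have hsub : A ⊆ Finset.univ.biUnion fun i : Fin n => s (Sum.inl i) := by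
      intro j hj
      obtain ⟨i, hi⟩ := (Finset.mem_filter.1 hj).2
      exact Finset.mem_biUnion.2 ⟨i, Finset.mem_univ i, h _ _ hi⟩
    have := (Finset.card_le_card hsub).trans
      (Finset.card_biUnion_le_card_mul _ _ _ fun i _ => hs (Sum.inl i))
    rw [Finset.card_univ, Fintype.card_fin] at this
    exact_mod_cast this
  · intro j _
    obtain ⟨η, hη⟩ := hcone j
    rw [hmarg j η hη]
    -- The infimum defining δ need not be attained here; a code-state within δ + ε suffices because
    -- η is the same for all code-states.
    refine le_of_forall_pos_le_add fun ε hε => ?_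
    obtain ⟨ρ, hρ, hlt⟩ := exists_mem_codeStates_lt hdist hδ0 hε
    have h1 : ((ρ - pureState ψ) * O j).trace = η := by
      rw [sub_mul, Matrix.trace_sub, trace_mul_of_mem_codeStates hρ hη,
        Matrix.trace_mul_comm (pureState ψ), hOψ, Matrix.trace_zero, sub_zero]
    have h2 := norm_trace_mul_le_traceNorm (ρ - pureState ψ) (O j) (norm_conj_occupation_le hT j)
    rw [h1] at h2
    exact ((Complex.re_le_norm η).trans h2).trans hlt.le
  · intro j hj
    have hempty : {i | reach c j (Sum.inl i)} = (∅ : Set (Fin n)) := by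
      ext i
      simp only [Set.mem_ofPred_eq, Set.mem_empty_iff_false, iff_false]
      exact fun h => hj (Finset.mem_filter.2 ⟨Finset.mem_univ j, i, h⟩)
    obtain ⟨z, hz⟩ := (hempty ▸ hsupp j).eq_smul_one
    have hz' : O j = z • 1 := hz
    -- The scalar O_j annihilates the nonzero vector ψ.
    have h0 : z = 0 := by
      have h := hOψ j
      rw [hz', Matrix.smul_mul, Matrix.one_mul, smul_eq_zero] at h
      refine h.resolve_right fun h => ?_
      have hψ0 : ψ = 0 := by
        ext x
        have := congrFun (congrFun h x) x
        simpa [pureState] using this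
      rw [hψ0, norm_zero] at hψ
      exact zero_ne_one hψ
    rw [hmarg j 0 (by rw [hz', h0]; simp), Complex.zero_re]

theorem logb_le_depth {k d a : ℕ} {C : Submodule ℂ (QSpace (Fin n))}
    (hC : IsCode C k d) {ψ : QSpace (Fin n)} (hψ : ‖ψ‖ = 1) {δ : ℝ}
    (hdist : traceDistToCode (pureState ψ) C = δ) (hδ0 : 0 < δ) (hδ1 : δ < 1 / 2)
    {c : Circuit (Fin n ⊕ Fin a)} (hc : traceAnc (circuitOutput c) = pureState ψ) :
    Real.logb 2 (min (d : ℝ) ((k : ℝ) / (2 * δ * Real.logb 2 (1 / δ) * (n : ℝ)))) ≤ c.length := by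
  have hl2 : 0 < Real.log 2 := Real.log_pos one_lt_two
  have hlδ : 0 < Real.log (1 / δ) := Real.log_pos (by rw [lt_div_iff₀ hδ0]; linarith)
  set h := 2 * δ * Real.logb 2 (1 / δ) with hh
  have hpos : 0 < h := by
    rw [hh, Real.logb]
    positivity
  by_contra hcon
  push Not at hcon
  set m := min (d : ℝ) ((k : ℝ) / (h * n))
  have hm0 : 0 ≤ m := le_min (by positivity) (by positivity)
  -- For m = 0 the convention `Real.logb 2 0 = 0` makes the claim trivial; this covers d = 0.
  have hm : 0 < m := by
    refine hm0.lt_of_ne fun h0 => ?_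
    rw [← h0, Real.logb_zero] at hcon
    exact absurd hcon (by simp)
  rw [Real.lt_logb_iff_rpow_lt one_lt_two hm, Real.rpow_natCast] at hcon
  obtain ⟨hd, hk⟩ := lt_min_iff.1 hcon
  -- Division by zero gives 0, so n = 0 would contradict m > 0.
  have hn : (0 : ℝ) < n := by
    refine lt_of_le_of_ne (Nat.cast_nonneg n) fun h0 => ?_
    have := (lt_min_iff.1 hm).2
    rw [← h0, mul_zero, div_zero] at this
    exact lt_irrefl _ this
  rw [lt_div_iff₀ (by positivity)] at hk
  have hdim := code_dimension_le_of_circuit hC hψ hdist hδ0 hδ1 hc (by exact_mod_cast hd)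
  have hent : Real.binEntropy δ ≤ h * Real.log 2 := by
    refine (binEntropy_le_two_mul hδ0 hδ1).trans_eq ?_
    rw [hh, Real.logb]
    field_simp
  have : (k : ℝ) * Real.log 2 ≤ n * 2 ^ c.length * (h * Real.log 2) :=
    hdim.trans (by gcongr)
  nlinarith

end Main

end QCode

theorem mainTheorem5 (n k d : ℕ)
    (C : Submodule ℂ (QCode.QSpace (Fin n))) (hC : QCode.IsCode C k d)
    (ψ : QCode.QSpace (Fin n)) (hψ : ‖ψ‖ = 1)
    (δ : ℝ) (hdist : QCode.traceDistToCode (QCode.pureState ψ) C = δ)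
    (hδ0 : 0 < δ) (hδ1 : δ < 1 / 2)
    (hk : 2 * δ * Real.logb 2 (1 / δ) * (n : ℝ) < (k : ℝ)) :
    ((Real.logb 2 (min (d : ℝ) ((k : ℝ) / (2 * δ * Real.logb 2 (1 / δ) * (n : ℝ)))) : ℝ) : EReal)
      ≤ (((QCode.cc (QCode.pureState ψ) : ℕ∞) : ℝ≥0∞) : EReal) := by
  set r := Real.logb 2 (min (d : ℝ) ((k : ℝ) / (2 * δ * Real.logb 2 (1 / δ) * (n : ℝ))))
  -- Depths are natural numbers, so the real bound rounds up to one in `ℕ∞`, where it passes to the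
  -- infimum over circuits.
  have h : ((⌈r⌉₊ : ℕ) : ℕ∞) ≤ QCode.cc (QCode.pureState ψ) :=
    le_iInf fun a => le_iInf fun c => le_iInf fun hc => by
      exact_mod_cast Nat.ceil_le.2 (QCode.logb_le_depth hC hψ hdist hδ0 hδ1 hc)
  calc (r : EReal) ≤ ((⌈r⌉₊ : ℝ) : EReal) := EReal.coe_le_coe_iff.2 (Nat.le_ceil r)
    _ = ((((⌈r⌉₊ : ℕ) : ℕ∞) : ℝ≥0∞) : EReal) := by rw [ENat.toENNReal_coe]; rfl
    _ ≤ _ := EReal.coe_ennreal_le_coe_ennreal_iff.2 (by exact_mod_cast h)
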